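/- **Model.** A network is a finite directed graph $G=(\mathcal V,\mathcal E)$ with, for each edge $e$, a memoryless channel $K_e$ with finite (nonempty) input and output alphabets; the channels on different edges are independent. Node $v$ holds an observation $W_v$. In a $T$-step algorithm, at each time $t=1,\dots,T$ every node $v$ sends one input symbol on each of its outgoing edges, computed by a deterministic encoder from $W_v$ and the symbols that it received at times $1,\dots,t-1$; after time $T$ it forms an estimate $\widehat Z_v$ of $Z$ by a deterministic function of $W_v$ and all the symbols that it received. For $\varepsilon\ge 0$ and $\delta\in[0,1)$, the computation time $T(\varepsilon,\delta)\in\{0,1,2,\dots\}\cup\{\infty\}$ is the infimum of the $T$ for which some $T$-step algorithm satisfies $\mathbb P[|Z-\widehat Z_v|>\varepsilon]\le\delta$ for all $v\in\mathcal V$. For $\mathcal S\subset\mathcal V$, the cutset capacity is $C_{\mathcal S}=\sum C_e$, the sum over the edges $e=(u,v)$ with $u\notin\mathcal S$, $v\in\mathcal S$, where $C_e$ is the Shannon capacity of $K_e$. Logarithms are binary, and $h_2(\delta)=-\delta\log\delta-(1-\delta)\log(1-\delta)$. **Corollary (linear functions of Rademacher observations).** Let $0\le\delta<1/2$. There is a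 function $c:\mathbb N\to\mathbb R$, depending on $\delta$ only, with $$c(n)\sim\frac{1-\delta}{2}\log\frac{\pi n}{2}-h_2(\delta)\qquad(n\to\infty),$$ i.e. the ratio of the two sides tends to $1$, such that for every network, all independent Rademacher observations $(W_v)_{v\in\mathcal V}$ (values $\pm1$ with probability $1/2$ each) and all real coefficients with $|a_v|\ge 1$ for all $v$, the computation times for $Z=\sum_{v\in\mathcal V}a_vW_v$ satisfy $$T(0,\delta)\;\ge\; T(1,\delta)\;\ge\;\max_{\emptyset\ne\mathcal S\subsetneq\mathcal V}\frac{c(|\mathcal V\setminus\mathcal S|)}{C_{\mathcal S}},$$ where, if $C_{\mathcal S}=0$, the quotient is read as $\infty$ when $c(|\mathcal V\setminus\mathcal S|)>0$ and as $0$ otherwise. That is, $$T(1,\delta)\gtrsim\max_{\mathcal S}\frac1{C_{\mathcal S}}\Big(\frac{1-\delta}{2}\log\frac{\pi|\mathcal V\setminus\mathcal S|}{2}-h_2(\delta)\Big)\quad\text{as }|\mathcal V\setminus\mathcal S|\to\infty.$$ -/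

import Mathlib

open MeasureTheory Filter Finset
open scoped ENNReal BigOperators

universe u v w z

/-- A network of independent memoryless channels: a finite directed graph with node set `V` and
edge set `E`, and for every edge `e` a finite input alphabet `X e`, a finite output alphabet `Y e`
and a stochastic transition law `K e x y = K_e(y | x)`. -/
structure Network (V : Type u) where
  E : Finset (V × V)
  X : {e : V × V // e ∈ E} → Type v
  Y : {e : V × V // e ∈ E} → Type v
  [fintypeX : ∀ e, Fintype (X e)]
  [fintypeY : ∀ e, Fintype (Y e)]
  [nonemptyX : ∀ e, Nonempty (X e)]
  K : ∀ e, X e → Y e → ℝ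
  K_nonneg : ∀ e x y, 0 ≤ K e x y
  K_sum : ∀ e x, ∑ y, K e x y = 1

/-- Mutual information `I(X;Y)`, in bits, between the input `X ∼ p` and the output `Y` of the
channel with transition law `K`. -/
noncomputable def channelMutualInfo {A B : Type*} [Fintype A] [Fintype B]
    (p : A → ℝ) (K : A → B → ℝ) : ℝ :=
  ∑ x, ∑ y, p x * K x y * Real.logb 2 (K x y / ∑ x', p x' * K x' y)

/-- Shannon capacity, in bits per channel use: the supremum of `I(X;Y)` over all input
distributions. -/
noncomputable def channelCapacity {A B : Type*} [Fintype A] [Fintype B] (K : A → B → ℝ) : ℝ :=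
  ⨆ p : stdSimplex ℝ A, channelMutualInfo (p : A → ℝ) K

namespace Network

variable {V : Type u}

attribute [instance] Network.fintypeX Network.fintypeY Network.nonemptyX

/-- The edges of the network; `e.1 = (u, v)` is an edge from `u` to `v`. -/
abbrev Edge (N : Network.{u, v} V) : Type u := {e : V × V // e ∈ N.E}

/-- What node `i` sends in one time step: one input symbol for every outgoing edge. -/
abbrev Sent (N : Network.{u, v} V) (i : V) : Type (max u v) :=
  ∀ e : {e : N.Edge // e.1.1 = i}, N.X e.1

/-- What node `i` receives in one time step: one output symbol from every incoming edge. -/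
abbrev Received (N : Network.{u, v} V) (i : V) : Type (max u v) :=
  ∀ e : {e : N.Edge // e.1.2 = i}, N.Y e.1

/-- A `T`-step algorithm for nodes with observation spaces `W i` and estimates in `Z`:
deterministic encoders and estimators. The encoder at time `t` (times are `0, …, T - 1`) sees the
node's own observation and the symbols it received at the `t` earlier times. -/
structure Algorithm (N : Network.{u, v} V) (W : V → Type w) [∀ i, MeasurableSpace (W i)]
    (Z : Type z) [MeasurableSpace Z] (T : ℕ) where
  enc : ∀ (i : V) (t : Fin T), W i → (Fin t → N.Received i) → N.Sent i
  est : ∀ i : V, W i → (Fin T → N.Received i) → Z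
  measurable_enc : ∀ i t h, @Measurable (W i) (N.Sent i) _ ⊤ (fun ω => enc i t ω h)
  measurable_est : ∀ i h, Measurable (fun ω => est i ω h)

namespace Algorithm

variable {N : Network.{u, v} V} {W : V → Type w} [∀ i, MeasurableSpace (W i)]
  {Z : Type z} [MeasurableSpace Z] {T : ℕ}

/-- The symbol sent along `e` at time `t`, when the observations are `ω` and the channel outputs
are `y`. -/
def input (A : N.Algorithm W Z T) (ω : ∀ i, W i) (y : Fin T → ∀ e : N.Edge, N.Y e)
    (t : Fin T) (e : N.Edge) : N.X e :=
  A.enc e.1.1 t (ω e.1.1) (fun s e' => y ⟨s, s.2.trans t.2⟩ e'.1) ⟨e, rfl⟩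

/-- The estimate of node `i` at the end, when the observations are `ω` and the channel outputs
are `y`. -/
def output (A : N.Algorithm W Z T) (ω : ∀ i, W i) (y : Fin T → ∀ e : N.Edge, N.Y e)
    (i : V) : Z :=
  A.est i (ω i) (fun s e => y s e.1)

/-- Conditional probability of the channel outputs `y`, given the observations `ω`. Each use of
each channel is independent of everything else, given its input. -/
noncomputable def outputsProb (A : N.Algorithm W Z T) (ω : ∀ i, W i)
    (y : Fin T → ∀ e : N.Edge, N.Y e) : ℝ :=
  ∏ t, ∏ e, N.K e (A.input ω y t e) (y t e)

/-- The excess distortion probability `ℙ[d(Z, Ẑ_i) > ε]` of node `i`, where `Z = f(W)` and the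
observations `W` have joint law `P`. -/
noncomputable def excessProb [DecidableEq V] (A : N.Algorithm W Z T) (P : Measure (∀ i, W i))
    (f : (∀ i, W i) → Z) (d : Z → Z → ℝ) (ε : ℝ) (i : V) : ℝ≥0∞ :=
  ∫⁻ ω, ∑ y : Fin T → ∀ e : N.Edge, N.Y e,
    (if ε < d (f ω) (A.output ω y i) then ENNReal.ofReal (A.outputsProb ω y) else 0) ∂P

end Algorithm

/-- The `(ε, δ)`-computation time: the infimum (`⊤` if there is none) of the `T` for which some
`T`-step algorithm has excess distortion probability at most `δ` at every node. -/
noncomputable def compTime [DecidableEq V] (N : Network.{u, v} V)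
    {W : V → Type w} [∀ i, MeasurableSpace (W i)] {Z : Type z} [MeasurableSpace Z]
    (P : Measure (∀ i, W i)) (f : (∀ i, W i) → Z) (d : Z → Z → ℝ) (ε δ : ℝ) : ℕ∞ :=
  ⨅ (T : ℕ) (_ : ∃ A : N.Algorithm W Z T, ∀ i, A.excessProb P f d ε i ≤ ENNReal.ofReal δ), (T : ℕ∞)

/-- The cutset capacity `C_S`: the total capacity of the edges from outside `S` into `S`. -/
noncomputable def cutsetCapacity [DecidableEq V] (N : Network.{u, v} V) (S : Finset V) : ℝ :=
  ∑ e : N.Edge with e.1.1 ∉ S ∧ e.1.2 ∈ S, channelCapacity (N.K e)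

end Network

/-- The Rademacher law on `ℝ`: the values `1` and `-1` with probability `1 / 2` each. -/
noncomputable def rademacher : Measure ℝ :=
  (2⁻¹ : ℝ≥0∞) • (Measure.dirac 1 + Measure.dirac (-1))

/-- `T(ε, δ)` for computing `∑ i, a i * W i` from independent Rademacher observations `W i`,
under the absolute error criterion. -/
noncomputable def rademacherSumTime {V : Type u} [Fintype V] [DecidableEq V]
    (N : Network.{u, v} V) (a : V → ℝ) (ε δ : ℝ) : ℕ∞ :=
  N.compTime (W := fun _ => ℝ) (Measure.pi fun _ => rademacher) (fun ω => ∑ i, a i * ω i)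
    (fun x y => |x - y|) ε δ

/-- The binary entropy function, in bits. -/
noncomputable def binaryEntropy (p : ℝ) : ℝ :=
  Real.binEntropy p / Real.log 2

/-! The proof is a change of measure across the cut. Keep the algorithm, but let every channel from
outside `S` into `S` emit, at each time, an independent symbol with the marginal law `outputLaw`
that it has in the true network. The likelihood ratio of the true network to this disconnected one
is a product over times and cut edges of K(y|x)/q(y). As q is the true marginal of each single use,
the divergence is exactly a sum of single-use mutual informations, hence at most T·C_S
(`log_outputsProb_sub_log`, `mean_logb_eq_channelMutualInfo`); feedback needs no separate treatment.

In the disconnected network a node of `S` learns nothing about the n signs outside `S`. Whatever it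
estimates, the Littlewood–Offord inequality bounds its probability of being within 1 of the sum by
1/M, with M = √(n+1)/2 (`disconnected_success_le`). In the true network this probability is at least
1 - δ. The inequality log x ≤ x - 1 turns this contrast into (1 - δ) log M - 1 ≤ divergence, in nats
(`logb_le_mul_cutsetCapacity`).

The resulting c(n) = (1 - δ) log₂ M - 1/ln 2 differs from the required expression by a bounded
amount, which the ratio does not see. This is why crude constants suffice throughout. -/

/-! ### Finite-horizon processes given by causal transition weights. -/

section CausalKernels

variable {Ω : Type*} {T : ℕ}

/-- The weight of a path under a family of causal transition weights. -/
def pathWeight (k : ∀ t : Fin T, (Fin t → Ω) → Ω → ℝ) (y : Fin T → Ω) : ℝ :=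
  ∏ t, k t (fun s => y ⟨s, s.2.trans t.2⟩) (y t)

lemma pathWeight_snoc (k : ∀ t : Fin (T + 1), (Fin t → Ω) → Ω → ℝ) (y : Fin T → Ω) (ω : Ω) :
    pathWeight k (Fin.snoc y ω : Fin (T + 1) → Ω) =
      pathWeight (fun t => k t.castSucc) y * k (Fin.last T) y ω := by
  unfold pathWeight
  rw [Fin.prod_univ_castSucc]
  congr 1
  · refine Finset.prod_congr rfl fun t _ => ?_
    rw [Fin.snoc_castSucc]
    congr 1
    funext s
    exact Fin.snoc_castSucc (α := fun _ => Ω) ω y ⟨s, s.2.trans t.2⟩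
  · rw [Fin.snoc_last]
    congr 1
    funext s
    exact Fin.snoc_castSucc (α := fun _ => Ω) ω y s

lemma pathWeight_nonneg {k : ∀ t : Fin T, (Fin t → Ω) → Ω → ℝ} (hk : ∀ t h ω, 0 ≤ k t h ω)
    (y : Fin T → Ω) : 0 ≤ pathWeight k y :=
  Finset.prod_nonneg fun _ _ => hk _ _ _

lemma sum_path_snoc [Fintype Ω] (f : (Fin (T + 1) → Ω) → ℝ) :
    ∑ y, f y = ∑ y : Fin T → Ω, ∑ ω : Ω, f (Fin.snoc y ω : Fin (T + 1) → Ω) := by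
  rw [← (Fin.snocEquiv fun _ => Ω).sum_comp, Fintype.sum_prod_type, Finset.sum_comm]
  rfl

lemma sum_pathWeight [Fintype Ω] (k : ∀ t : Fin T, (Fin t → Ω) → Ω → ℝ)
    (hk : ∀ t h, ∑ ω, k t h ω = 1) : ∑ y, pathWeight k y = 1 := by
  induction T with
  | zero => simp [pathWeight]
  | succ T ih =>
    simp_rw [sum_path_snoc, pathWeight_snoc, ← Finset.mul_sum]
    calc _ = ∑ y, pathWeight (fun t => k t.castSucc) y :=
          Finset.sum_congr rfl fun y _ => by rw [hk (Fin.last T) y, mul_one]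
      _ = 1 := ih _ fun t h => hk t.castSucc h

/-- The conditional law of the `t`-th coordinate, given the past, is `k t`. -/
lemma sum_pathWeight_mul_step [Fintype Ω] (k : ∀ t : Fin T, (Fin t → Ω) → Ω → ℝ)
    (hk : ∀ t h, ∑ ω, k t h ω = 1) (t : Fin T) (G : (Fin t → Ω) → Ω → ℝ) :
    ∑ y, pathWeight k y * G (fun s => y ⟨s, s.2.trans t.2⟩) (y t) =
      ∑ y, pathWeight k y * ∑ ω, k t (fun s => y ⟨s, s.2.trans t.2⟩) ω *
        G (fun s => y ⟨s, s.2.trans t.2⟩) ω := by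
  induction T with
  | zero => exact t.elim0
  | succ T ih =>
    have hpast : ∀ (t : Fin (T + 1)) (y : Fin T → Ω) (ω : Ω) (s : Fin t),
        (Fin.snoc y ω : Fin (T + 1) → Ω) ⟨s, s.2.trans t.2⟩ =
          y ⟨s, s.2.trans_le (Nat.le_of_lt_succ t.2)⟩ := fun t y ω s =>
      Fin.snoc_castSucc (α := fun _ => Ω) ω y ⟨s, s.2.trans_le (Nat.le_of_lt_succ t.2)⟩
    simp_rw [sum_path_snoc, pathWeight_snoc, hpast]
    -- Only the last time has content: for an earlier `t` the final transition sums to one and drops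
    -- out of both sides.
    induction t using Fin.lastCases with
    | last =>
      refine Finset.sum_congr rfl fun y _ => ?_
      simp_rw [Fin.snoc_last]
      rw [← Finset.sum_mul, ← Finset.mul_sum, hk (Fin.last T) y, mul_one, Finset.mul_sum]
      exact Finset.sum_congr rfl fun ω _ => mul_assoc _ _ _
    | cast t =>
      simp_rw [Fin.snoc_castSucc, ← Finset.sum_mul, ← Finset.mul_sum]
      have h1 : ∀ y : Fin T → Ω, ∑ ω, k (Fin.last T) y ω = 1 := fun y => hk (Fin.last T) y
      simp_rw [h1, mul_one]
      exact ih (fun t => k t.castSucc) (fun t h => hk t.castSucc h) t G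

/-- Two families of causal transition weights whose transitions agree on the functions that are
invariant under a relation `r` give the same sums of the path functions invariant under `r`. -/
lemma sum_pathWeight_congr [Fintype Ω] (k k' : ∀ t : Fin T, (Fin t → Ω) → Ω → ℝ)
    (r : Ω → Ω → Prop) (hr : ∀ ω, r ω ω)
    (hkk : ∀ t h h', (∀ s, r (h s) (h' s)) → ∀ G : Ω → ℝ, (∀ ω ω', r ω ω' → G ω = G ω') →
      ∑ ω, k t h ω * G ω = ∑ ω, k' t h' ω * G ω)
    (F : (Fin T → Ω) → ℝ) (hF : ∀ y y', (∀ t, r (y t) (y' t)) → F y = F y') :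
    ∑ y, pathWeight k y * F y = ∑ y, pathWeight k' y * F y := by
  induction T with
  | zero => simp [pathWeight]
  | succ T ih =>
    have hsnoc : ∀ (y y' : Fin T → Ω) (ω ω' : Ω), (∀ s, r (y s) (y' s)) → r ω ω' →
        F (Fin.snoc y ω : Fin (T + 1) → Ω) = F (Fin.snoc y' ω' : Fin (T + 1) → Ω) := by
      intro y y' ω ω' hy hω
      refine hF _ _ fun t => ?_
      induction t using Fin.lastCases with
      | last => simpa using hω
      | cast t => simpa using hy t
    simp_rw [sum_path_snoc, pathWeight_snoc, mul_assoc, ← Finset.mul_sum]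
    rw [ih (fun t => k t.castSucc) (fun t => k' t.castSucc)
      (fun t h h' => hkk t.castSucc h h')
      (fun y => ∑ ω, k (Fin.last T) y ω * F (Fin.snoc y ω : Fin (T + 1) → Ω))]
    · refine Finset.sum_congr rfl fun y _ => ?_
      congr 1
      exact hkk (Fin.last T) y y (fun s => hr _) _ fun ω ω' h => hsnoc _ _ _ _ (fun s => hr _) h
    · intro y y' hy
      -- `hkk` only compares `k` with `k'`, so replacing the history `y` by `y'` inside `k` passes
      -- through `k'`.
      calc _ = ∑ ω, k' (Fin.last T) y' ω * F (Fin.snoc y ω : Fin (T + 1) → Ω) :=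
            hkk (Fin.last T) y y' hy _ fun ω ω' h => hsnoc _ _ _ _ (fun s => hr _) h
        _ = ∑ ω, k (Fin.last T) y' ω * F (Fin.snoc y ω : Fin (T + 1) → Ω) :=
            (hkk (Fin.last T) y' y' (fun s => hr _) _
              fun ω ω' h => hsnoc _ _ _ _ (fun s => hr _) h).symm
        _ = _ := Finset.sum_congr rfl fun ω _ => by rw [hsnoc y y' ω ω hy (hr _)]

end CausalKernels

/-! ### Marginals of finite product laws. -/

section ProductKernels

variable {ι : Type*} [Fintype ι] [DecidableEq ι] {Y : ι → Type*} [∀ i, Fintype (Y i)]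

lemma sum_prod_eq_one (κ : ∀ i, Y i → ℝ) (hκ : ∀ i, ∑ y, κ i y = 1) :
    ∑ ω : ∀ i, Y i, ∏ i, κ i (ω i) = 1 := by
  have := (Finset.prod_univ_sum (fun i => (Finset.univ : Finset (Y i))) κ).symm
  simpa [hκ] using this

/-- The sum of a function of some coordinates under a product law only depends on the factors at
these coordinates. -/
lemma sum_prod_mul_congr (p : ι → Prop) [DecidablePred p] (κ κ' : ∀ i, Y i → ℝ)
    (hκ : ∀ i, ∑ y, κ i y = 1) (hκ' : ∀ i, ∑ y, κ' i y = 1) (h : ∀ i, p i → κ i = κ' i)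
    (G : (∀ i, Y i) → ℝ) (hG : ∀ ω ω', (∀ i, p i → ω i = ω' i) → G ω = G ω') :
    ∑ ω, (∏ i, κ i (ω i)) * G ω = ∑ ω, (∏ i, κ' i (ω i)) * G ω := by
  have key : ∀ κ : ∀ i, Y i → ℝ, (∀ i, ∑ y, κ i y = 1) → ∀ b₀ : ∀ i : {i // ¬ p i}, Y i,
      ∑ ω, (∏ i, κ i (ω i)) * G ω =
      ∑ a : ∀ i : {i // p i}, Y i, (∏ i : {i // p i}, κ i (a i)) *
        G ((Equiv.piEquivPiSubtypeProd p Y).symm (a, b₀)) := by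
    intro κ hκ b₀
    rw [← (Equiv.piEquivPiSubtypeProd p Y).symm.sum_comp, Fintype.sum_prod_type]
    refine Finset.sum_congr rfl fun a _ => ?_
    have h1 : ∀ b, (∏ i, κ i ((Equiv.piEquivPiSubtypeProd p Y).symm (a, b) i)) =
        (∏ i : {i // p i}, κ i (a i)) * ∏ i : {i // ¬ p i}, κ i (b i) := by
      intro b
      rw [← Fintype.prod_subtype_mul_prod_subtype p]
      congr 1
      · exact Finset.prod_congr rfl fun i _ => by simp [i.2]
      · exact Finset.prod_congr rfl fun i _ => by simp [i.2]
    have h2 : ∀ b, G ((Equiv.piEquivPiSubtypeProd p Y).symm (a, b)) =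
        G ((Equiv.piEquivPiSubtypeProd p Y).symm (a, b₀)) := fun b =>
      hG _ _ fun i hi => by simp [hi]
    simp_rw [h1, h2, ← Finset.sum_mul, ← Finset.mul_sum]
    rw [sum_prod_eq_one (fun i : {i // ¬ p i} => κ i) fun i => hκ i, mul_one]
  -- An empty sum cannot equal 1; the base point `b₀` outside `p` therefore exists.
  have hne : ∀ i, Nonempty (Y i) := by
    intro i
    by_contra hn
    rw [not_nonempty_iff] at hn
    simpa using hκ i
  rw [key κ hκ fun i => (hne i).some, key κ' hκ' fun i => (hne i).some]
  refine Finset.sum_congr rfl fun a _ => ?_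
  congr 1
  exact Finset.prod_congr rfl fun i _ => by rw [h i i.2]

lemma sum_prod_mul_single (κ : ∀ i, Y i → ℝ) (hκ : ∀ i, ∑ y, κ i y = 1) (i : ι) (φ : Y i → ℝ) :
    ∑ ω : ∀ i, Y i, (∏ j, κ j (ω j)) * φ (ω i) = ∑ y, κ i y * φ y := by
  -- Absorbing φ into the `i`-th factor keeps the product form, and all other factors sum to one.
  have h := (Finset.prod_univ_sum (fun i => (Finset.univ : Finset (Y i)))
    (Function.update κ i fun y => κ i y * φ y)).symm
  rw [Fintype.piFinset_univ, Fintype.prod_eq_single i, Function.update_self] at h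
  · rw [← h]
    refine Finset.sum_congr rfl fun ω _ => ?_
    rw [← Finset.mul_prod_erase _ _ (Finset.mem_univ i),
      ← Finset.mul_prod_erase (a := i) _ (fun j => Function.update κ i _ j (ω j)) (Finset.mem_univ i),
      Function.update_self, mul_right_comm]
    congr 1
    exact Finset.prod_congr rfl fun j hj => by
      rw [Function.update_of_ne (Finset.ne_of_mem_erase hj)]
  · intro j hj
    rw [Function.update_of_ne hj, hκ]

end ProductKernels

/-! ### Anticoncentration of signed sums. -/

section LittlewoodOfford

/-- The sign `1` or `-1` encoded by a Boolean. -/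
def boolSign (b : Bool) : ℝ := if b then 1 else -1

variable {ι : Type*} [Fintype ι] [DecidableEq ι]

/-- Erdős' form of the Littlewood–Offord inequality, for half-open intervals. -/
lemma card_signs_Ico_le (a : ι → ℝ) (ha : ∀ i, 1 ≤ |a i|) (x : ℝ) :
    #{u : ι → Bool | x ≤ ∑ i, a i * boolSign (u i) ∧ ∑ i, a i * boolSign (u i) < x + 2} ≤
      (Fintype.card ι).choose (Fintype.card ι / 2) := by
  classical
  set s : Finset (ι → Bool) :=
    {u | x ≤ ∑ i, a i * boolSign (u i) ∧ ∑ i, a i * boolSign (u i) < x + 2} with hs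
  -- `A u` collects the indices whose term equals +|a i|; making the set larger increases the sum,
  -- whatever the signs of the coefficients.
  let A : (ι → Bool) → Finset ι := fun u => {i | u i = decide (0 < a i)}
  have hmem : ∀ u i, i ∈ A u ↔ u i = decide (0 < a i) := fun u i => by simp [A]
  have hinj : Function.Injective A := by
    intro u u' h
    funext i
    have h1 : i ∈ A u ↔ i ∈ A u' := by rw [h]
    rw [hmem, hmem] at h1
    generalize decide (0 < a i) = b at h1
    revert h1
    cases u i <;> cases u' i <;> cases b <;> decide
  have hterm : ∀ u i, a i * boolSign (u i) = if i ∈ A u then |a i| else -|a i| := by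
    intro u i
    simp only [hmem]
    have h0 := ha i
    rcases lt_or_ge 0 (a i) with h | h
    · rw [abs_of_pos h]
      cases u i <;> simp [h, boolSign]
    · rw [abs_of_nonpos h]
      cases u i <;> simp [h.not_gt, boolSign]
  have hanti : IsAntichain (· ⊆ ·) (SetLike.coe (s.image A)) := by
    rintro _ hB _ hB' hne hsub
    rw [SetLike.mem_coe, Finset.mem_image] at hB hB'
    obtain ⟨u, hu, rfl⟩ := hB
    obtain ⟨u', hu', rfl⟩ := hB'
    simp only [hs, Finset.mem_filter, Finset.mem_univ, true_and] at hu hu'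
    obtain ⟨j, hj', hj⟩ := Finset.exists_of_ssubset (hsub.ssubset_of_ne hne)
    -- An index gained from `A u` to `A u'` adds 2|a j| ≥ 2 and none is lost, so both sums cannot
    -- lie in a half-open interval of length 2. Sperner's theorem then applies.
    have h2 : 2 ≤ ∑ i, (a i * boolSign (u' i) - a i * boolSign (u i)) := by
      refine le_trans ?_ (Finset.single_le_sum (f := fun i =>
        a i * boolSign (u' i) - a i * boolSign (u i)) (fun i _ => ?_) (Finset.mem_univ j))
      · simp only [hterm, hj', hj, if_true, if_false]
        linarith [ha j]
      · simp only [hterm]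
        have h0 := ha i
        by_cases h : i ∈ A u
        · simp [h, hsub h]
        · by_cases h' : i ∈ A u'
          · simp [h, h']
          · simp [h, h']
    rw [Finset.sum_sub_distrib] at h2
    linarith
  rw [← Finset.card_image_of_injective s hinj]
  exact hanti.sperner

/-- The closed interval [z - 1, z + 1] needs two half-open ones because of its right endpoint. The
factor 2 costs a bounded number of bits. -/
lemma card_signs_abs_sub_le (a : ι → ℝ) (ha : ∀ i, 1 ≤ |a i|) (z : ℝ) :
    #{u : ι → Bool | |∑ i, a i * boolSign (u i) - z| ≤ 1} ≤
      2 * (Fintype.card ι).choose (Fintype.card ι / 2) := by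
  rw [two_mul]
  refine le_trans (Finset.card_le_card ?_) ((Finset.card_union_le _ _).trans
    (add_le_add (card_signs_Ico_le a ha (z - 1)) (card_signs_Ico_le a ha (z + 1))))
  intro u hu
  simp only [Finset.mem_filter, Finset.mem_univ, true_and, Finset.mem_union] at hu ⊢
  rw [abs_le] at hu
  rcases lt_or_ge (∑ i, a i * boolSign (u i)) (z + 1) with h | h
  · left; constructor <;> linarith
  · right; constructor <;> linarith

/-- An elementary substitute for Stirling's formula: the left side grows at each step by the factor
4(2n+1)(2n+3)/(n+1)² ≤ 16. The order 1/√n is right; only the constant is lost. -/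
lemma centralBinom_sq_mul_le (n : ℕ) : n.centralBinom ^ 2 * (2 * n + 1) ≤ 16 ^ n := by
  induction n with
  | zero => simp
  | succ n ih =>
    have h := Nat.succ_mul_centralBinom_succ n
    have h1 : (n + 1) ^ 2 * ((n + 1).centralBinom ^ 2 * (2 * (n + 1) + 1)) =
        (n.centralBinom ^ 2 * (2 * n + 1)) * (4 * ((2 * n + 1) * (2 * n + 3))) := by
      calc _ = ((n + 1) * (n + 1).centralBinom) ^ 2 * (2 * (n + 1) + 1) := by ring
        _ = _ := by rw [h]; ring
    have h2 : 4 * ((2 * n + 1) * (2 * n + 3)) ≤ 16 * (n + 1) ^ 2 := by nlinarith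
    refine le_of_mul_le_mul_left (a := (n + 1) ^ 2) ?_ (pow_pos n.succ_pos 2)
    calc _ = _ := h1
      _ ≤ 16 ^ n * (16 * (n + 1) ^ 2) := Nat.mul_le_mul ih h2
      _ = _ := by ring

lemma choose_half_sq_mul_le (n : ℕ) : n.choose (n / 2) ^ 2 * (n + 1) ≤ 4 ^ n := by
  obtain ⟨m, rfl | rfl⟩ := n.even_or_odd'
  · rw [Nat.mul_div_cancel_left _ two_pos, ← Nat.centralBinom_eq_two_mul_choose, pow_mul]
    exact centralBinom_sq_mul_le m
  · have h1 : (2 * m + 1) / 2 = m := by omega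
    -- The two central entries of the odd row 2m + 1 are equal and add up to the next central
    -- binomial coefficient.
    have h2 : (m + 1).centralBinom = 2 * (2 * m + 1).choose m := by
      rw [Nat.centralBinom_eq_two_mul_choose, show 2 * (m + 1) = 2 * m + 1 + 1 by ring,
        Nat.choose_succ_succ, Nat.choose_symm_half]
      ring
    have h3 := centralBinom_sq_mul_le (m + 1)
    rw [h2] at h3
    rw [h1]
    have h4 : (16 : ℕ) ^ (m + 1) = 4 * 4 ^ (2 * m + 1) := by
      rw [pow_succ 4, pow_mul, pow_succ]; norm_num; ring
    nlinarith [h3, h4]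

/-- A signed sum of `n` coefficients of modulus at least `1` lies in an interval of length `2`
with probability at most `2 / √(n + 1)`. -/
lemma card_signs_abs_sub_le_sqrt (a : ι → ℝ) (ha : ∀ i, 1 ≤ |a i|) (z : ℝ) :
    (#{u : ι → Bool | |∑ i, a i * boolSign (u i) - z| ≤ 1} : ℝ) ≤
      2 / √(Fintype.card ι + 1) * 2 ^ Fintype.card ι := by
  set n := Fintype.card ι
  have hc : (n.choose (n / 2) : ℝ) * √(n + 1) ≤ 2 ^ n := by
    refine (sq_le_sq₀ (by positivity) (by positivity)).1 ?_
    rw [mul_pow, Real.sq_sqrt (by positivity), ← pow_mul, mul_comm n, pow_mul]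
    norm_num
    exact_mod_cast choose_half_sq_mul_le n
  have h := card_signs_abs_sub_le a ha z
  calc _ ≤ ((2 * n.choose (n / 2) : ℕ) : ℝ) := by exact_mod_cast h
    _ ≤ _ := by
      rw [div_mul_eq_mul_div, le_div_iff₀ (by positivity)]
      push_cast
      linarith

end LittlewoodOfford

/-! ### Mutual information is bounded by capacity. -/

section Capacity

variable {A B : Type*} [Fintype A] [Fintype B]

/-- A real supremum is a true upper bound only for a bounded family. A crude bound is enough: the
output law at y is at least p(x)K(y|x), so the ratio in the logarithm is at most 1/p(x), and log r ≤
r cancels p(x). -/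
lemma channelMutualInfo_le (K : A → B → ℝ) (hK : ∀ x y, 0 ≤ K x y) (hK1 : ∀ x, ∑ y, K x y = 1)
    (p : stdSimplex ℝ A) :
    channelMutualInfo (p : A → ℝ) K ≤ Fintype.card A * (Real.log 2)⁻¹ := by
  obtain ⟨p, hp0, hp1⟩ := p
  have hlog : 0 < Real.log 2 := Real.log_pos one_lt_two
  have hterm : ∀ x y, p x * K x y * Real.logb 2 (K x y / ∑ x', p x' * K x' y) ≤
      K x y * (Real.log 2)⁻¹ := by
    intro x y
    rcases (hp0 x).eq_or_lt with h | hpx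
    · rw [← h, zero_mul, zero_mul]
      exact mul_nonneg (hK x y) (inv_nonneg.2 hlog.le)
    rcases (hK x y).eq_or_lt with h | hKx
    · simp [← h]
    have hq : p x * K x y ≤ ∑ x', p x' * K x' y :=
      Finset.single_le_sum (f := fun x' => p x' * K x' y)
        (fun x' _ => mul_nonneg (hp0 x') (hK x' y)) (Finset.mem_univ x)
    have hpK := mul_pos hpx hKx
    have hle : K x y / ∑ x', p x' * K x' y ≤ (p x)⁻¹ := by
      rw [div_le_iff₀ (hpK.trans_le hq), ← div_eq_inv_mul, le_div_iff₀ hpx, mul_comm]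
      exact hq
    have h1 : Real.log (K x y / ∑ x', p x' * K x' y) ≤ (p x)⁻¹ :=
      (Real.log_le_sub_one_of_pos (div_pos hKx (hpK.trans_le hq))).trans (by linarith)
    rw [Real.logb, div_eq_mul_inv, ← mul_assoc]
    refine mul_le_mul_of_nonneg_right ?_ (inv_nonneg.2 hlog.le)
    calc _ ≤ p x * K x y * (p x)⁻¹ := mul_le_mul_of_nonneg_left h1 hpK.le
      _ = K x y := by field_simp
  calc _ ≤ ∑ x, ∑ y, K x y * (Real.log 2)⁻¹ :=
        Finset.sum_le_sum fun x _ => Finset.sum_le_sum fun y _ => hterm x y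
    _ = _ := by simp [← Finset.sum_mul, hK1]

lemma channelMutualInfo_le_capacity (K : A → B → ℝ) (hK : ∀ x y, 0 ≤ K x y)
    (hK1 : ∀ x, ∑ y, K x y = 1) (p : A → ℝ) (hp : p ∈ stdSimplex ℝ A) :
    channelMutualInfo p K ≤ channelCapacity K :=
  le_ciSup (f := fun p : stdSimplex ℝ A => channelMutualInfo (p : A → ℝ) K)
    ⟨_, Set.forall_mem_range.2 (channelMutualInfo_le K hK hK1)⟩ ⟨p, hp⟩

end Capacity

/-! ### Reduction of the Rademacher product law to uniform sign vectors. -/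

section Rademacher

variable {V : Type*} [Fintype V] [DecidableEq V]

instance : IsFiniteMeasure rademacher := by
  unfold rademacher
  exact ⟨by simp⟩

lemma pi_rademacher : Measure.pi (fun _ : V => rademacher) =
    ∑ u : V → Bool, (2⁻¹ : ℝ≥0∞) ^ Fintype.card V • Measure.dirac fun i => boolSign (u i) := by
  refine Measure.pi_eq fun s hs => ?_
  have h1 : ∀ i, rademacher (s i) = ∑ b : Bool, 2⁻¹ * (s i).indicator 1 (boolSign b) := by
    intro i
    simp [rademacher, boolSign]
  simp_rw [h1, Finset.prod_univ_sum, Fintype.piFinset_univ, Finset.prod_mul_distrib]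
  simp only [Measure.finsetSum_apply, Measure.smul_apply, smul_eq_mul]
  refine Finset.sum_congr rfl fun u _ => ?_
  rw [Finset.prod_const, Finset.card_univ]
  congr 1
  rw [Measure.dirac_apply]
  by_cases h : ∀ i, boolSign (u i) ∈ s i
  · rw [Finset.prod_eq_one fun i _ => by simp [h i]]
    simp [Set.mem_pi, h]
  · obtain ⟨i, hi⟩ := not_forall.1 h
    rw [Finset.prod_eq_zero (Finset.mem_univ i) (by simp [hi])]
    simp [Set.mem_pi, h]

/-- The law is a finite sum of point masses, so `f` may be arbitrary, with no measurability
condition. -/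
lemma lintegral_pi_rademacher (f : (V → ℝ) → ℝ≥0∞) :
    ∫⁻ ω, f ω ∂Measure.pi (fun _ : V => rademacher) =
      ∑ u : V → Bool, (2⁻¹ : ℝ≥0∞) ^ Fintype.card V * f fun i => boolSign (u i) := by
  rw [pi_rademacher, lintegral_finsetSum_measure]
  simp

end Rademacher

/-! ### The network with a disconnected cut. -/

namespace Network.Algorithm

variable {V : Type u} {N : Network.{u, v} V} {W : V → Type w}
  [∀ i, MeasurableSpace (W i)] {Z : Type z} [MeasurableSpace Z] {T : ℕ}

lemma outputsProb_nonneg (A : N.Algorithm W Z T) (ω : ∀ i, W i)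
    (y : Fin T → ∀ e : N.Edge, N.Y e) : 0 ≤ A.outputsProb ω y :=
  Finset.prod_nonneg fun _ _ => Finset.prod_nonneg fun _ _ => N.K_nonneg _ _ _

variable [DecidableEq V]

/-- The symbol sent along `e` at time `t`, as a function of the channel outputs before `t`. -/
def inputOf (A : N.Algorithm W Z T) (ω : ∀ i, W i) (t : Fin T)
    (h : Fin t → ∀ e : N.Edge, N.Y e) (e : N.Edge) : N.X e :=
  A.enc e.1.1 t (ω e.1.1) (fun s e' => h s e'.1) ⟨e, rfl⟩

/-- The transition weights when the law of the output of every edge into `S` from outside is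
replaced by `q`, regardless of its input. -/
noncomputable def cutTrans (A : N.Algorithm W Z T) (S : Finset V)
    (q : Fin T → ∀ e : N.Edge, N.Y e → ℝ) (ω : ∀ i, W i) (t : Fin T)
    (h : Fin t → ∀ e : N.Edge, N.Y e) (y : ∀ e : N.Edge, N.Y e) : ℝ :=
  ∏ e, (if e.1.1 ∉ S ∧ e.1.2 ∈ S then q t e else N.K e (A.inputOf ω t h e)) (y e)

/-- The transition weights of the channel outputs. -/
noncomputable def trans (A : N.Algorithm W Z T) (ω : ∀ i, W i) (t : Fin T)
    (h : Fin t → ∀ e : N.Edge, N.Y e) (y : ∀ e : N.Edge, N.Y e) : ℝ :=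
  ∏ e, N.K e (A.inputOf ω t h e) (y e)

lemma sum_trans (A : N.Algorithm W Z T) (ω : ∀ i, W i) (t : Fin T)
    (h : Fin t → ∀ e : N.Edge, N.Y e) : ∑ y, A.trans ω t h y = 1 :=
  sum_prod_eq_one (fun e => N.K e (A.inputOf ω t h e)) fun e => N.K_sum e _

lemma sum_outputsProb (A : N.Algorithm W Z T) (ω : ∀ i, W i) :
    ∑ y, A.outputsProb ω y = 1 :=
  sum_pathWeight _ (A.sum_trans ω)

lemma sum_cutTrans (A : N.Algorithm W Z T) (S : Finset V)
    (q : Fin T → ∀ e : N.Edge, N.Y e → ℝ) (hq : ∀ t e, ∑ y, q t e y = 1) (ω : ∀ i, W i)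
    (t : Fin T) (h : Fin t → ∀ e : N.Edge, N.Y e) : ∑ y, A.cutTrans S q ω t h y = 1 := by
  refine sum_prod_eq_one
    (fun e : N.Edge => if e.1.1 ∉ S ∧ e.1.2 ∈ S then q t e else N.K e (A.inputOf ω t h e)) ?_
  intro e
  split_ifs
  · exact hq t e
  · exact N.K_sum e _

lemma cutTrans_nonneg (A : N.Algorithm W Z T) (S : Finset V)
    (q : Fin T → ∀ e : N.Edge, N.Y e → ℝ) (hq : ∀ t e y, 0 ≤ q t e y) (ω : ∀ i, W i)
    (t : Fin T) (h : Fin t → ∀ e : N.Edge, N.Y e) (y : ∀ e : N.Edge, N.Y e) :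
    0 ≤ A.cutTrans S q ω t h y :=
  Finset.prod_nonneg fun e _ => by
    split_ifs
    · exact hq t e _
    · exact N.K_nonneg e _ _

/-- Once the cut is disconnected, what is received inside `S` does not depend on the observations
outside `S`. -/
lemma sum_pathWeight_cutTrans_congr (A : N.Algorithm W Z T) (S : Finset V)
    (q : Fin T → ∀ e : N.Edge, N.Y e → ℝ) (hq : ∀ t e, ∑ y, q t e y = 1) (ω ω' : ∀ i, W i)
    (hω : ∀ i ∈ S, ω i = ω' i) (F : (Fin T → ∀ e : N.Edge, N.Y e) → ℝ)
    (hF : ∀ y y', (∀ t (e : N.Edge), e.1.2 ∈ S → y t e = y' t e) → F y = F y') :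
    ∑ y, pathWeight (A.cutTrans S q ω) y * F y = ∑ y, pathWeight (A.cutTrans S q ω') y * F y := by
  refine sum_pathWeight_congr _ _ (fun y y' => ∀ e : N.Edge, e.1.2 ∈ S → y e = y' e)
    (fun _ _ _ => rfl) ?_ F hF
  intro t h h' hh G hG
  refine sum_prod_mul_congr (fun e : N.Edge => e.1.2 ∈ S) _ _ ?_ ?_ ?_ G hG
  · intro e
    split_ifs
    · exact hq t e
    · exact N.K_sum e _
  · intro e
    split_ifs
    · exact hq t e
    · exact N.K_sum e _
  · intro e he
    -- An edge into `S` either starts in `S`, and its input uses only data available in `S`, or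
    -- crosses the cut and has the fixed law `q`.
    by_cases hS : e.1.1 ∈ S
    · have h1 : A.inputOf ω t h e = A.inputOf ω' t h' e := by
        unfold inputOf
        rw [hω _ hS]
        congr 1
        funext s e'
        exact hh s e'.1 (by rw [e'.2]; exact hS)
      rw [h1]
    · rw [if_pos ⟨hS, he⟩, if_pos ⟨hS, he⟩]

/-! ### Divergence between the true and the disconnected network. -/

section UniformObservations

variable {U : Type*} [Fintype U]

/-- The law of the symbol sent along `e` at time `t`, when the vector of observations is `ω i`
for a uniformly random `i`. -/
noncomputable def inputLaw (A : N.Algorithm W Z T) (ω : U → ∀ i, W i) (t : Fin T) (e : N.Edge)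
    (x : N.X e) : ℝ :=
  open Classical in
  (Fintype.card U : ℝ)⁻¹ * ∑ i, ∑ y, A.outputsProb (ω i) y *
    if A.input (ω i) y t e = x then 1 else 0

/-- The law of the symbol received along `e` at time `t`. -/
noncomputable def outputLaw (A : N.Algorithm W Z T) (ω : U → ∀ i, W i) (t : Fin T) (e : N.Edge)
    (y : N.Y e) : ℝ :=
  ∑ x, A.inputLaw ω t e x * N.K e x y

lemma inputLaw_nonneg (A : N.Algorithm W Z T) (ω : U → ∀ i, W i) (t : Fin T) (e : N.Edge)
    (x : N.X e) : 0 ≤ A.inputLaw ω t e x := by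
  classical
  refine mul_nonneg (by positivity) (Finset.sum_nonneg fun i _ => Finset.sum_nonneg fun y _ =>
    mul_nonneg (A.outputsProb_nonneg _ _) ?_)
  split_ifs <;> norm_num

lemma sum_inputLaw_mul (A : N.Algorithm W Z T) (ω : U → ∀ i, W i) (t : Fin T) (e : N.Edge)
    (ψ : N.X e → ℝ) : ∑ x, A.inputLaw ω t e x * ψ x =
      (Fintype.card U : ℝ)⁻¹ * ∑ i, ∑ y, A.outputsProb (ω i) y * ψ (A.input (ω i) y t e) := by
  classical
  unfold inputLaw
  simp_rw [mul_assoc, ← Finset.mul_sum, Finset.sum_mul]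
  congr 1
  rw [Finset.sum_comm]
  refine Finset.sum_congr rfl fun i _ => ?_
  rw [Finset.sum_comm]
  refine Finset.sum_congr rfl fun y _ => ?_
  simp

lemma inputLaw_mem_stdSimplex [Nonempty U] (A : N.Algorithm W Z T) (ω : U → ∀ i, W i) (t : Fin T)
    (e : N.Edge) : A.inputLaw ω t e ∈ stdSimplex ℝ (N.X e) := by
  refine ⟨A.inputLaw_nonneg ω t e, ?_⟩
  have h := A.sum_inputLaw_mul ω t e fun _ => 1
  simp only [mul_one, sum_outputsProb] at h
  rw [h]
  simp

lemma outputLaw_nonneg (A : N.Algorithm W Z T) (ω : U → ∀ i, W i) (t : Fin T) (e : N.Edge)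
    (y : N.Y e) : 0 ≤ A.outputLaw ω t e y :=
  Finset.sum_nonneg fun _ _ => mul_nonneg (A.inputLaw_nonneg _ _ _ _) (N.K_nonneg _ _ _)

lemma sum_outputLaw [Nonempty U] (A : N.Algorithm W Z T) (ω : U → ∀ i, W i) (t : Fin T)
    (e : N.Edge) : ∑ y, A.outputLaw ω t e y = 1 := by
  unfold outputLaw
  rw [Finset.sum_comm]
  simp_rw [← Finset.mul_sum, N.K_sum, mul_one]
  exact (A.inputLaw_mem_stdSimplex ω t e).2

/-- Absolute continuity: a symbol that occurs with positive probability has positive marginal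
weight, so the likelihood ratio is finite. -/
lemma outputLaw_pos [Nonempty U] (A : N.Algorithm W Z T) (ω : U → ∀ i, W i) (t : Fin T)
    (e : N.Edge) (i : U) (y : Fin T → ∀ e : N.Edge, N.Y e) (hy : 0 < A.outputsProb (ω i) y)
    (hK : 0 < N.K e (A.input (ω i) y t e) (y t e)) : 0 < A.outputLaw ω t e (y t e) := by
  classical
  have h1 : 0 < A.inputLaw ω t e (A.input (ω i) y t e) := by
    have hnn : ∀ (j : U) (y' : Fin T → ∀ e : N.Edge, N.Y e), 0 ≤ A.outputsProb (ω j) y' *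
        if A.input (ω j) y' t e = A.input (ω i) y t e then (1 : ℝ) else 0 := fun j y' =>
      mul_nonneg (A.outputsProb_nonneg _ _) (by split_ifs <;> norm_num)
    refine mul_pos (by positivity) (Finset.sum_pos' (fun j _ => Finset.sum_nonneg fun y' _ =>
      hnn j y') ⟨i, Finset.mem_univ i, Finset.sum_pos' (fun y' _ => hnn i y')
        ⟨y, Finset.mem_univ y, ?_⟩⟩)
    simpa using hy
  exact Finset.sum_pos' (fun x _ => mul_nonneg (A.inputLaw_nonneg _ _ _ _) (N.K_nonneg _ _ _))
    ⟨_, Finset.mem_univ _, mul_pos h1 hK⟩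

/-- The mean information density of one use of one channel is the mutual information between its
input and its output. -/
lemma mean_logb_eq_channelMutualInfo (A : N.Algorithm W Z T) (ω : U → ∀ i, W i) (t : Fin T)
    (e : N.Edge) :
    (Fintype.card U : ℝ)⁻¹ * ∑ i, ∑ y, A.outputsProb (ω i) y *
      Real.logb 2 (N.K e (A.input (ω i) y t e) (y t e) / A.outputLaw ω t e (y t e)) =
      channelMutualInfo (A.inputLaw ω t e) (N.K e) := by
  have h1 : ∀ i, ∑ y, A.outputsProb (ω i) y *
      Real.logb 2 (N.K e (A.input (ω i) y t e) (y t e) / A.outputLaw ω t e (y t e)) =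
      ∑ y, A.outputsProb (ω i) y * ∑ b, N.K e (A.input (ω i) y t e) b *
        Real.logb 2 (N.K e (A.input (ω i) y t e) b / A.outputLaw ω t e b) := by
    intro i
    -- Given the past, the input along `e` is determined; averaging over the fresh output leaves a
    -- function of that input alone, to be integrated against `inputLaw`.
    refine (sum_pathWeight_mul_step (A.trans (ω i)) (A.sum_trans (ω i)) t fun h y =>
      Real.logb 2 (N.K e (A.inputOf (ω i) t h e) (y e) / A.outputLaw ω t e (y e))).trans ?_
    refine Finset.sum_congr rfl fun y _ => ?_
    congr 1
    exact sum_prod_mul_single (fun e' => N.K e' (A.input (ω i) y t e')) (fun e' => N.K_sum e' _) e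
      fun b => Real.logb 2 (N.K e (A.input (ω i) y t e) b / A.outputLaw ω t e b)
  simp_rw [h1]
  rw [← A.sum_inputLaw_mul ω t e fun x => ∑ b, N.K e x b *
    Real.logb 2 (N.K e x b / A.outputLaw ω t e b)]
  unfold channelMutualInfo outputLaw
  simp_rw [Finset.mul_sum, mul_assoc]

/-- The logarithm of the likelihood ratio between the channel outputs and those of the network
whose cut is disconnected. -/
lemma log_outputsProb_sub_log [Nonempty U] (A : N.Algorithm W Z T) (S : Finset V)
    (ω : U → ∀ i, W i) (i : U) (y : Fin T → ∀ e : N.Edge, N.Y e)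
    (hy : 0 < A.outputsProb (ω i) y) :
    0 < pathWeight (A.cutTrans S (A.outputLaw ω) (ω i)) y ∧
    Real.log (A.outputsProb (ω i) y) -
        Real.log (pathWeight (A.cutTrans S (A.outputLaw ω) (ω i)) y) =
      ∑ t, ∑ e : N.Edge with e.1.1 ∉ S ∧ e.1.2 ∈ S,
        Real.log (N.K e (A.input (ω i) y t e) (y t e) / A.outputLaw ω t e (y t e)) := by
  have hK : ∀ t e, 0 < N.K e (A.input (ω i) y t e) (y t e) := by
    intro t e
    refine (N.K_nonneg _ _ _).lt_of_ne fun h0 => hy.ne' ?_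
    exact Finset.prod_eq_zero (Finset.mem_univ t) (Finset.prod_eq_zero (Finset.mem_univ e) h0.symm)
  have hq : ∀ t e, 0 < A.outputLaw ω t e (y t e) := fun t e =>
    A.outputLaw_pos ω t e i y hy (hK t e)
  have hκ : ∀ t (e : N.Edge), 0 < (if e.1.1 ∉ S ∧ e.1.2 ∈ S then A.outputLaw ω t e
      else N.K e (A.input (ω i) y t e)) (y t e) := by
    intro t e
    split_ifs
    · exact hq t e
    · exact hK t e
  have hpw : pathWeight (A.cutTrans S (A.outputLaw ω) (ω i)) y =
      ∏ t, ∏ e : N.Edge, (if e.1.1 ∉ S ∧ e.1.2 ∈ S then A.outputLaw ω t e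
        else N.K e (A.input (ω i) y t e)) (y t e) := rfl
  rw [hpw]
  refine ⟨Finset.prod_pos fun t _ => Finset.prod_pos fun e _ => hκ t e, ?_⟩
  unfold outputsProb
  rw [Real.log_prod fun t _ => (Finset.prod_pos fun e _ => hK t e).ne',
    Real.log_prod fun t _ => (Finset.prod_pos fun e _ => hκ t e).ne', ← Finset.sum_sub_distrib]
  refine Finset.sum_congr rfl fun t _ => ?_
  rw [Real.log_prod fun e _ => (hK t e).ne', Real.log_prod fun e _ => (hκ t e).ne',
    ← Finset.sum_sub_distrib, Finset.sum_filter]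
  refine Finset.sum_congr rfl fun e _ => ?_
  -- Edges off the cut have the same factor in both networks and cancel.
  split_ifs
  · rw [Real.log_div (hK t e).ne' (hq t e).ne']
  · exact sub_self _

/-- If an event has probability at least `1 - δ`, but probability at most `M⁻¹` once the cut is
disconnected, then about `(1 - δ) log M` bits must have crossed the cut. -/
lemma logb_le_mul_cutsetCapacity [Nonempty U] (A : N.Algorithm W Z T) (S : Finset V)
    (ω : U → ∀ i, W i) (D : U → (Fin T → ∀ e : N.Edge, N.Y e) → Prop)
    [∀ i y, Decidable (D i y)] (δ M : ℝ) (hM : 1 ≤ M)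
    (hP : 1 - δ ≤ (Fintype.card U : ℝ)⁻¹ *
      ∑ i, ∑ y, A.outputsProb (ω i) y * if D i y then 1 else 0)
    (hQ : (Fintype.card U : ℝ)⁻¹ * ∑ i, ∑ y,
      pathWeight (A.cutTrans S (A.outputLaw ω) (ω i)) y * (if D i y then 1 else 0) ≤ M⁻¹) :
    (1 - δ) * Real.logb 2 M - 1 / Real.log 2 ≤ T * N.cutsetCapacity S := by
  have hM0 : 0 < M := one_pos.trans_le hM
  have hlog : 0 < Real.log 2 := Real.log_pos one_lt_two
  set Q := fun i y => pathWeight (A.cutTrans S (A.outputLaw ω) (ω i)) y with hQdef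
  have hQ0 : ∀ i y, 0 ≤ Q i y := fun i y =>
    pathWeight_nonneg (A.cutTrans_nonneg S _ (A.outputLaw_nonneg ω) (ω i)) y
  have hQ1 : ∀ i, ∑ y, Q i y = 1 := fun i =>
    sum_pathWeight _ (A.sum_cutTrans S _ (A.sum_outputLaw ω) (ω i))
  set R : U → (Fin T → ∀ e : N.Edge, N.Y e) → ℝ := fun i y =>
    ∑ t, ∑ e : N.Edge with e.1.1 ∉ S ∧ e.1.2 ∈ S,
      Real.log (N.K e (A.input (ω i) y t e) (y t e) / A.outputLaw ω t e (y t e)) with hR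
  -- Pointwise form of the variational bound for the divergence, with test function log M on `D` and
  -- 0 off `D`. Summed, the terms 1 and -∑ Q cancel and M·Q(D) ≤ 1 is what remains to be paid.
  have hpoint : ∀ i y, A.outputsProb (ω i) y +
      (A.outputsProb (ω i) y * if D i y then 1 else 0) * Real.log M -
      (M * (Q i y * if D i y then 1 else 0) + Q i y) ≤ A.outputsProb (ω i) y * R i y := by
    intro i y
    rcases (A.outputsProb_nonneg (ω i) y).eq_or_lt with h0 | hpos
    · rw [← h0]
      have : 0 ≤ M * (Q i y * if D i y then 1 else 0) :=
        mul_nonneg hM0.le (mul_nonneg (hQ0 i y) (by split_ifs <;> norm_num))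
      linarith [hQ0 i y]
    · obtain ⟨hQpos, hRe⟩ := A.log_outputsProb_sub_log S ω i y hpos
      rw [show R i y = _ from hRe.symm]
      set p := A.outputsProb (ω i) y
      -- This is log x ≤ x - 1 at x = sQ/p, multiplied by p; it is used with s = M on `D` and s = 1
      -- off `D`.
      have hgen : ∀ s : ℝ, 0 < s → p + p * Real.log s - s * Q i y ≤
          p * (Real.log p - Real.log (Q i y)) := by
        intro s hs
        have h1 := Real.log_le_sub_one_of_pos (div_pos (mul_pos hs hQpos) hpos)
        rw [Real.log_div (mul_pos hs hQpos).ne' hpos.ne', Real.log_mul hs.ne' hQpos.ne'] at h1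
        have h2 := mul_le_mul_of_nonneg_left h1 hpos.le
        rw [mul_sub p (s * _ / p), mul_div_cancel₀ _ hpos.ne'] at h2
        simp only [hQdef]
        linarith
      split_ifs
      · linarith [hgen M hM0, hQ0 i y]
      · have := hgen 1 one_pos
        rw [Real.log_one] at this
        linarith
  have hcard : 0 < (Fintype.card U : ℝ) := by exact_mod_cast Fintype.card_pos
  have hsum := mul_le_mul_of_nonneg_left (Finset.sum_le_sum fun i (_ : i ∈ Finset.univ) =>
    Finset.sum_le_sum fun y (_ : y ∈ Finset.univ) => hpoint i y) (inv_nonneg.2 hcard.le)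
  simp only [Finset.sum_sub_distrib, Finset.sum_add_distrib, ← Finset.mul_sum, ← Finset.sum_mul,
    sum_outputsProb, hQ1, Finset.sum_const, Finset.card_univ, nsmul_eq_mul, mul_one] at hsum
  have hright : (Fintype.card U : ℝ)⁻¹ * ∑ i, ∑ y, A.outputsProb (ω i) y * R i y ≤
      T * N.cutsetCapacity S * Real.log 2 := by
    have h1 : (Fintype.card U : ℝ)⁻¹ * ∑ i, ∑ y, A.outputsProb (ω i) y * R i y =
        ∑ t : Fin T, ∑ e : N.Edge with e.1.1 ∉ S ∧ e.1.2 ∈ S,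
          channelMutualInfo (A.inputLaw ω t e) (N.K e) * Real.log 2 := by
      simp_rw [← mean_logb_eq_channelMutualInfo, hR, Finset.mul_sum, Finset.sum_mul]
      have h2 : ∀ i : U, ∑ y, ∑ t, ∑ e : N.Edge with e.1.1 ∉ S ∧ e.1.2 ∈ S,
          (Fintype.card U : ℝ)⁻¹ * (A.outputsProb (ω i) y *
            Real.log (N.K e (A.input (ω i) y t e) (y t e) / A.outputLaw ω t e (y t e))) =
          ∑ t, ∑ e : N.Edge with e.1.1 ∉ S ∧ e.1.2 ∈ S, ∑ y,
          (Fintype.card U : ℝ)⁻¹ * (A.outputsProb (ω i) y *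
            Real.log (N.K e (A.input (ω i) y t e) (y t e) / A.outputLaw ω t e (y t e))) := by
        intro i
        rw [Finset.sum_comm]
        exact Finset.sum_congr rfl fun t _ => Finset.sum_comm
      rw [Finset.sum_congr rfl fun i _ => h2 i, Finset.sum_comm]
      refine Finset.sum_congr rfl fun t _ => ?_
      rw [Finset.sum_comm]
      refine Finset.sum_congr rfl fun e _ => Finset.sum_congr rfl fun i _ =>
        Finset.sum_congr rfl fun y _ => ?_
      rw [Real.logb]
      field_simp
    rw [h1]
    calc _ ≤ ∑ t : Fin T, ∑ e : N.Edge with e.1.1 ∉ S ∧ e.1.2 ∈ S,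
          channelCapacity (N.K e) * Real.log 2 :=
          Finset.sum_le_sum fun t _ => Finset.sum_le_sum fun e _ =>
            mul_le_mul_of_nonneg_right (channelMutualInfo_le_capacity _ (N.K_nonneg e)
              (N.K_sum e) _ (A.inputLaw_mem_stdSimplex ω t e)) hlog.le
      _ = _ := by
        rw [Finset.sum_const, Finset.card_univ, Fintype.card_fin, nsmul_eq_mul, ← Finset.sum_mul,
          mul_assoc]
        rfl
  have hlogM : 0 ≤ Real.log M := Real.log_nonneg hM
  have hP' := mul_le_mul_of_nonneg_right hP hlogM
  have hQ' := mul_le_mul_of_nonneg_left hQ hM0.le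
  rw [mul_inv_cancel₀ hM0.ne'] at hQ'
  have hmain := hsum.trans hright
  rw [mul_sub, mul_add, mul_add, inv_mul_cancel₀ hcard.ne'] at hmain
  have hfin : (1 - δ) * Real.log M - 1 ≤ T * N.cutsetCapacity S * Real.log 2 := by
    simp only [hQdef] at hmain
    linarith
  rw [Real.logb, ← mul_div_assoc, ← sub_div, div_le_iff₀ hlog]
  exact hfin

end UniformObservations

end Network.Algorithm

lemma Network.compTime_anti {V : Type u} [DecidableEq V] (N : Network.{u, v} V)
    {W : V → Type w} [∀ i, MeasurableSpace (W i)] {Z : Type z} [MeasurableSpace Z]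
    (P : Measure (∀ i, W i)) (f : (∀ i, W i) → Z) (d : Z → Z → ℝ) (δ : ℝ) :
    Antitone fun ε => N.compTime P f d ε δ := by
  intro ε ε' hε
  refine iInf_mono fun T => iInf_mono' fun ⟨A, hA⟩ => ⟨⟨A, fun i => le_trans ?_ (hA i)⟩, le_rfl⟩
  refine lintegral_mono fun ω => Finset.sum_le_sum fun y _ => ?_
  by_cases h : ε' < d (f ω) (A.output ω y i)
  · rw [if_pos h, if_pos (hε.trans_lt h)]
  · rw [if_neg h]
    exact zero_le

/-! ### Application to sums of Rademacher observations. -/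

section RademacherSum

open Network

variable {V : Type u} [Fintype V] [DecidableEq V] {N : Network.{u, v} V} {T : ℕ}

/-- Sums of a function over sign vectors, split into coordinates inside and outside `S`. -/
lemma sum_signs_split (S : Finset V) (f : (V → Bool) → ℝ) :
    ∑ u, f u = ∑ b : {i // i ∈ S} → Bool, ∑ c : {i // i ∉ S} → Bool,
      f ((Equiv.piEquivPiSubtypeProd (· ∈ S) fun _ => Bool).symm (b, c)) := by
  rw [← (Equiv.piEquivPiSubtypeProd (· ∈ S) fun _ => Bool).symm.sum_comp, Fintype.sum_prod_type]

/-- With the cut disconnected, a node of `S` computes the sum with small probability only. -/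
lemma disconnected_success_le (A : N.Algorithm (fun _ => ℝ) ℝ T) (S : Finset V)
    (q : Fin T → ∀ e : N.Edge, N.Y e → ℝ) (hq : ∀ t e y, 0 ≤ q t e y)
    (hq1 : ∀ t e, ∑ y, q t e y = 1) (a : V → ℝ) (ha : ∀ i, 1 ≤ |a i|) (v : V) (hv : v ∈ S) :
    ((Fintype.card (V → Bool) : ℕ) : ℝ)⁻¹ * ∑ u : V → Bool, ∑ y,
      pathWeight (A.cutTrans S q fun i => boolSign (u i)) y *
      (if |∑ i, a i * boolSign (u i) - A.output (fun i => boolSign (u i)) y v| ≤ 1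
        then (1 : ℝ) else 0) ≤
      2 / √((Finset.univ \ S).card + 1) := by
  set L : ℝ := 2 / √((Finset.univ \ S).card + 1) with hL
  have hcardc : Fintype.card {i // i ∉ S} = (Finset.univ \ S).card :=
    Fintype.card_of_subtype _ (by simp)
  let glue := fun (b : {i // i ∈ S} → Bool) (c : {i // i ∉ S} → Bool) =>
    (Equiv.piEquivPiSubtypeProd (· ∈ S) fun _ => Bool).symm (b, c)
  have hglue : ∀ b c c', ∀ i ∈ S, glue b c i = glue b c' i := by
    intro b c c' i hi
    simp [glue, hi]
  have hsum : ∀ b c, ∑ i, a i * boolSign (glue b c i) =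
      ∑ i : {i // i ∈ S}, a i * boolSign (b i) + ∑ i : {i // i ∉ S}, a i * boolSign (c i) := by
    intro b c
    rw [← Fintype.sum_subtype_add_sum_subtype (· ∈ S)]
    congr 1
    · exact Finset.sum_congr (by ext; simp) fun i _ => by simp [glue]
    · exact Finset.sum_congr rfl fun i _ => by simp [glue, i.2]
  have hout : ∀ (b) (c c') (y y' : Fin T → ∀ e : N.Edge, N.Y e),
      (∀ t (e : N.Edge), e.1.2 ∈ S → y t e = y' t e) →
      A.output (fun i => boolSign (glue b c i)) y v =
        A.output (fun i => boolSign (glue b c' i)) y' v := by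
    intro b c c' y y' hy
    change A.est v (boolSign (glue b c v)) _ = A.est v (boolSign (glue b c' v)) _
    rw [hglue b c c' v hv]
    congr 1
    funext t e
    exact hy t e.1 (by rw [e.2]; exact hv)
  have hb : ∀ b, ∑ c, ∑ y, pathWeight (A.cutTrans S q fun i => boolSign (glue b c i)) y *
      (if |∑ i, a i * boolSign (glue b c i) -
        A.output (fun i => boolSign (glue b c i)) y v| ≤ 1 then (1 : ℝ) else 0) ≤
      L * 2 ^ Fintype.card {i // i ∉ S} := by
    intro b
    let c₀ : {i // i ∉ S} → Bool := fun _ => true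
    -- With the signs `b` inside `S` fixed, neither the law of what reaches `S` nor the estimate
    -- depends on `c`. Freezing both at `c₀` allows the sums to be exchanged, and `c` is then
    -- counted for a fixed estimate.
    have h1 : ∀ c, ∑ y, pathWeight (A.cutTrans S q fun i => boolSign (glue b c i)) y *
        (if |∑ i, a i * boolSign (glue b c i) -
          A.output (fun i => boolSign (glue b c i)) y v| ≤ 1 then (1 : ℝ) else 0) =
        ∑ y, pathWeight (A.cutTrans S q fun i => boolSign (glue b c₀ i)) y *
        (if |∑ i, a i * boolSign (glue b c i) -
          A.output (fun i => boolSign (glue b c₀ i)) y v| ≤ 1 then (1 : ℝ) else 0) := by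
      intro c
      simp_rw [hout b c c₀ _ _ fun _ _ _ => rfl]
      refine A.sum_pathWeight_cutTrans_congr S q hq1 _ _ (fun i hi => ?_) _ fun y y' hy => ?_
      · simp only [hglue b c c₀ i hi]
      · simp only [hout b c₀ c₀ y y' hy]
    rw [Finset.sum_congr rfl fun c _ => h1 c, Finset.sum_comm]
    calc _ ≤ ∑ y, pathWeight (A.cutTrans S q fun i => boolSign (glue b c₀ i)) y *
          (L * 2 ^ Fintype.card {i // i ∉ S}) := by
          refine Finset.sum_le_sum fun y _ => ?_
          rw [← Finset.mul_sum]
          refine mul_le_mul_of_nonneg_left ?_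
            (pathWeight_nonneg (A.cutTrans_nonneg S q hq _) y)
          -- The known part of the sum is moved to the centre of the interval, leaving only the
          -- coefficients outside `S`.
          have h2 := card_signs_abs_sub_le_sqrt (fun i : {i // i ∉ S} => a i) (fun i => ha i)
            (A.output (fun i => boolSign (glue b c₀ i)) y v -
              ∑ i : {i // i ∈ S}, a i * boolSign (b i))
          rw [hcardc] at h2 ⊢
          refine le_trans (le_of_eq ?_) h2
          rw [Finset.sum_boole]
          congr 2
          refine Finset.filter_congr fun c _ => ?_
          rw [hsum, sub_sub_eq_add_sub, add_comm]
      _ = _ := by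
          rw [← Finset.sum_mul, sum_pathWeight _ (A.sum_cutTrans S q hq1 _), one_mul]
  rw [sum_signs_split S]
  refine (mul_le_mul_of_nonneg_left (Finset.sum_le_sum fun b _ => hb b) (by positivity)).trans ?_
  have hcard : Fintype.card (V → Bool) =
      2 ^ Fintype.card {i // i ∈ S} * 2 ^ Fintype.card {i // i ∉ S} := by
    rw [Fintype.card_congr (Equiv.piEquivPiSubtypeProd (· ∈ S) fun _ => Bool), Fintype.card_prod]
    simp
  rw [hcard, Finset.sum_const, Finset.card_univ, nsmul_eq_mul]
  simp only [Fintype.card_pi, Fintype.card_bool, Finset.prod_const, Finset.card_univ]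
  push_cast
  refine le_of_eq ?_
  field_simp

lemma one_sub_le_success (A : N.Algorithm (fun _ => ℝ) ℝ T) (f : (V → ℝ) → ℝ) (v : V)
    {ε δ : ℝ} (hδ : 0 ≤ δ)
    (h : A.excessProb (Measure.pi fun _ => rademacher) f (fun x y => |x - y|) ε v ≤
      ENNReal.ofReal δ) :
    1 - δ ≤ ((Fintype.card (V → Bool) : ℕ) : ℝ)⁻¹ * ∑ u : V → Bool, ∑ y,
      A.outputsProb (fun i => boolSign (u i)) y *
      (if |f (fun i => boolSign (u i)) - A.output (fun i => boolSign (u i)) y v| ≤ ε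
        then (1 : ℝ) else 0) := by
  unfold Algorithm.excessProb at h
  rw [lintegral_pi_rademacher] at h
  have hc : (2⁻¹ : ℝ≥0∞) ^ Fintype.card V =
      ENNReal.ofReal ((Fintype.card (V → Bool) : ℕ) : ℝ)⁻¹ := by
    rw [ENNReal.ofReal_inv_of_pos (by positivity), ENNReal.ofReal_natCast, ENNReal.inv_pow.symm]
    simp
  have hnn : ∀ (u : V → Bool) (y : Fin T → ∀ e : N.Edge, N.Y e),
      0 ≤ if ε < |f (fun i => boolSign (u i)) - A.output (fun i => boolSign (u i)) y v| then
        A.outputsProb (fun i => boolSign (u i)) y else 0 := by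
    intro u y
    split_ifs
    · exact A.outputsProb_nonneg _ _
    · exact le_rfl
  have h1 : ∀ (u : V → Bool) (y : Fin T → ∀ e : N.Edge, N.Y e),
      (if ε < |f (fun i => boolSign (u i)) - A.output (fun i => boolSign (u i)) y v| then
        ENNReal.ofReal (A.outputsProb (fun i => boolSign (u i)) y) else 0) =
      ENNReal.ofReal (if ε < |f (fun i => boolSign (u i)) -
        A.output (fun i => boolSign (u i)) y v| then
        A.outputsProb (fun i => boolSign (u i)) y else 0) := by
    intro u y
    split_ifs <;> simp
  simp_rw [h1, hc] at h
  simp_rw [← ENNReal.ofReal_sum_of_nonneg fun y _ => hnn _ y] at h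
  rw [← Finset.mul_sum, ← ENNReal.ofReal_sum_of_nonneg fun u _ =>
    Finset.sum_nonneg fun y _ => hnn u y, ← ENNReal.ofReal_mul (by positivity),
    ENNReal.ofReal_le_ofReal_iff hδ] at h
  have h2 : (1 : ℝ) = ((Fintype.card (V → Bool) : ℕ) : ℝ)⁻¹ * ∑ u : V → Bool, ∑ y,
      A.outputsProb (fun i => boolSign (u i)) y := by
    simp [Algorithm.sum_outputsProb]
  rw [sub_le_iff_le_add]
  refine h2.trans_le (le_trans (le_of_eq ?_) (add_le_add_right h _))
  rw [← mul_add, ← Finset.sum_add_distrib]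
  congr 1
  refine Finset.sum_congr rfl fun u _ => ?_
  rw [← Finset.sum_add_distrib]
  refine Finset.sum_congr rfl fun y _ => ?_
  by_cases hd : |f (fun i => boolSign (u i)) - A.output (fun i => boolSign (u i)) y v| ≤ ε
  · simp [hd, hd.not_gt]
  · simp [hd, not_le.1 hd]

/-- The number of bits about a sum of `n` Rademacher variables that has to cross a cut. -/
noncomputable def rademacherBits (δ : ℝ) (n : ℕ) : ℝ :=
  (1 - δ) * Real.logb 2 (√(n + 1) / 2) - 1 / Real.log 2

/-- The two sides differ by a convergent sequence while the comparison function tends to infinity;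
here δ < 1 makes the leading coefficient positive. -/
lemma rademacherBits_isEquivalent (δ : ℝ) (hδ : δ < 1) :
    Asymptotics.IsEquivalent atTop (rademacherBits δ)
      (fun n : ℕ => (1 - δ) / 2 * Real.logb 2 (Real.pi * n / 2) - binaryEntropy δ) := by
  have hlog : 0 < Real.log 2 := Real.log_pos one_lt_two
  have htop : Tendsto (fun n : ℕ => (1 - δ) / 2 * Real.logb 2 (Real.pi * n / 2) -
      binaryEntropy δ) atTop atTop := by
    refine tendsto_atTop_add_const_right _ _ (Tendsto.const_mul_atTop (by linarith) ?_)
    refine (Real.tendsto_logb_atTop one_lt_two).comp ?_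
    refine Tendsto.atTop_div_const two_pos ?_
    exact tendsto_natCast_atTop_atTop.const_mul_atTop Real.pi_pos
  set C : ℝ := (1 - δ) / 2 * (Real.logb 2 (Real.pi / 2)) + (1 - δ) + 1 / Real.log 2 -
    binaryEntropy δ with hC
  have hdiff : (rademacherBits δ - fun n : ℕ =>
      (1 - δ) / 2 * Real.logb 2 (Real.pi * n / 2) - binaryEntropy δ) =ᶠ[atTop]
      fun n : ℕ => (1 - δ) / 2 * Real.logb 2 ((n + 1 : ℝ) / n) - C := by
    filter_upwards [eventually_gt_atTop 0] with n hn
    have hn' : (0 : ℝ) < n := by exact_mod_cast hn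
    simp only [Pi.sub_apply, rademacherBits, hC]
    rw [Real.logb_div (Real.sqrt_pos.2 (by positivity)).ne' two_ne_zero,
      Real.logb_div (x := n + 1) (by positivity) hn'.ne', mul_div_right_comm,
      Real.logb_mul (by positivity) hn'.ne', Real.sqrt_eq_rpow,
      Real.logb_rpow_eq_mul_logb_of_pos (by positivity),
      Real.logb_self_eq_one one_lt_two]
    ring
  have hbdd : (fun n : ℕ => (1 - δ) / 2 * Real.logb 2 ((n + 1 : ℝ) / n) - C) =O[atTop]
      (fun _ => (1 : ℝ)) := by
    have h1 : Tendsto (fun n : ℕ => ((n + 1 : ℝ) / n)) atTop (nhds 1) := by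
      simpa using (tendsto_natCast_div_add_atTop (1 : ℝ)).inv₀ one_ne_zero
    have h2 : Tendsto (fun n : ℕ => Real.logb 2 ((n + 1 : ℝ) / n)) atTop
        (nhds (Real.logb 2 1)) :=
      (Real.continuousAt_logb one_ne_zero).tendsto.comp h1
    exact ((h2.const_mul ((1 - δ) / 2)).sub_const C).isBigO_one ℝ
  exact (hbdd.congr' hdiff.symm EventuallyEq.rfl).trans_isLittleO
    (Asymptotics.isLittleO_const_left.2 (Or.inr (tendsto_norm_atTop_atTop.comp htop)))

lemma rademacherBits_le (A : N.Algorithm (fun _ => ℝ) ℝ T) (a : V → ℝ) (ha : ∀ i, 1 ≤ |a i|)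
    (δ : ℝ) (hδ₀ : 0 ≤ δ) (S : Finset V) (v : V) (hv : v ∈ S)
    (hM : 1 ≤ √((Finset.univ \ S).card + 1) / 2)
    (h : A.excessProb (Measure.pi fun _ => rademacher) (fun ω => ∑ i, a i * ω i)
      (fun x y => |x - y|) 1 v ≤ ENNReal.ofReal δ) :
    rademacherBits δ (Finset.univ \ S).card ≤ T * N.cutsetCapacity S := by
  have hP := one_sub_le_success A (fun ω => ∑ i, a i * ω i) v hδ₀ h
  let ω : (V → Bool) → V → ℝ := fun u i => boolSign (u i)
  have hQ := disconnected_success_le A S (A.outputLaw ω) (A.outputLaw_nonneg ω)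
    (A.sum_outputLaw ω) a ha v hv
  rw [← inv_div] at hQ
  exact A.logb_le_mul_cutsetCapacity S ω
    (fun u y => |∑ i, a i * boolSign (u i) - A.output (ω u) y v| ≤ 1) δ _ hM hP hQ

/-- Division in `ℝ≥0∞` gives x/0 = ∞ for x > 0 and 0/0 = 0, and `ENNReal.ofReal` sends negative bit
counts to 0, which is the intended reading of the quotient. -/
lemma ofReal_rademacherBits_div_le (N : Network.{u, v} V) (a : V → ℝ) (ha : ∀ i, 1 ≤ |a i|)
    (δ : ℝ) (hδ₀ : 0 ≤ δ) (hδ : δ < 1) (S : Finset V) (hS : S.Nonempty) :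
    ENNReal.ofReal (rademacherBits δ (Finset.univ \ S).card) /
      ENNReal.ofReal (N.cutsetCapacity S) ≤ (rademacherSumTime N a 1 δ : ℝ≥0∞) := by
  have key : ∀ T : ℕ, (∃ A : N.Algorithm (fun _ => ℝ) ℝ T, ∀ i,
      A.excessProb (Measure.pi fun _ => rademacher) (fun ω => ∑ i, a i * ω i)
        (fun x y => |x - y|) 1 i ≤ ENNReal.ofReal δ) →
      ENNReal.ofReal (rademacherBits δ (Finset.univ \ S).card) /
        ENNReal.ofReal (N.cutsetCapacity S) ≤ (T : ℝ≥0∞) := by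
    rintro T ⟨A, hA⟩
    obtain ⟨v, hv⟩ := hS
    refine ENNReal.div_le_of_le_mul ?_
    rw [← ENNReal.ofReal_natCast, ← ENNReal.ofReal_mul (Nat.cast_nonneg T)]
    rcases le_total 1 (√((Finset.univ \ S).card + 1) / 2) with hM | hM
    · exact ENNReal.ofReal_le_ofReal (rademacherBits_le A a ha δ hδ₀ S v hv hM (hA v))
    -- Here M ≤ 1, the divergence bound is not available, and the bit count is negative, so the
    -- claim is trivial.
    · rw [ENNReal.ofReal_of_nonpos]
      · exact zero_le
      · have h1 : Real.logb 2 (√((Finset.univ \ S).card + 1) / 2) ≤ 0 :=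
          Real.logb_nonpos one_lt_two (by positivity) hM
        have h2 : 0 < Real.log 2 := Real.log_pos one_lt_two
        have h3 := mul_nonpos_of_nonneg_of_nonpos (sub_nonneg.2 hδ.le) h1
        have h4 : 0 < 1 / Real.log 2 := by positivity
        unfold rademacherBits
        linarith
  by_cases htop : rademacherSumTime N a 1 δ = ⊤
  · rw [htop]
    exact le_top
  have hmem : rademacherSumTime N a 1 δ = ⨅ T : {T : ℕ // ∃ A : N.Algorithm (fun _ => ℝ) ℝ T, ∀ i,
      A.excessProb (Measure.pi fun _ => rademacher) (fun ω => ∑ i, a i * ω i)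
        (fun x y => |x - y|) 1 i ≤ ENNReal.ofReal δ}, ((T : ℕ) : ℕ∞) := by
    rw [iInf_subtype]
    rfl
  rcases isEmpty_or_nonempty {T : ℕ // ∃ A : N.Algorithm (fun _ => ℝ) ℝ T, ∀ i,
      A.excessProb (Measure.pi fun _ => rademacher) (fun ω => ∑ i, a i * ω i)
        (fun x y => |x - y|) 1 i ≤ ENNReal.ofReal δ} with hem | hne
  · exact absurd (by rw [hmem, iInf_of_empty]) htop
  -- A nonempty infimum in `ℕ∞` is attained, so the computation time is that of an actual algorithm.
  · obtain ⟨T, hT⟩ := ENat.exists_eq_iInf fun T : {T : ℕ // ∃ A : N.Algorithm (fun _ => ℝ) ℝ T,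
      ∀ i, A.excessProb (Measure.pi fun _ => rademacher) (fun ω => ∑ i, a i * ω i)
        (fun x y => |x - y|) 1 i ≤ ENNReal.ofReal δ} => ((T : ℕ) : ℕ∞)
    rw [hmem, ← hT]
    exact key T T.2

end RademacherSum

theorem mainTheorem11 (δ : ℝ) (hδ₀ : 0 ≤ δ) (hδ : δ < 1 / 2) :
    ∃ c : ℕ → ℝ,
      Asymptotics.IsEquivalent atTop c
        (fun n : ℕ => (1 - δ) / 2 * Real.logb 2 (Real.pi * n / 2) - binaryEntropy δ) ∧
      ∀ (V : Type u) [Fintype V] [DecidableEq V] (N : Network.{u, v} V) (a : V → ℝ),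
        (∀ i, 1 ≤ |a i|) →
          rademacherSumTime N a 1 δ ≤ rademacherSumTime N a 0 δ ∧
          ⨆ S ∈ {S : Finset V | S.Nonempty ∧ S ≠ Finset.univ},
              ENNReal.ofReal (c (Finset.univ \ S).card) / ENNReal.ofReal (N.cutsetCapacity S) ≤
            (rademacherSumTime N a 1 δ : ℝ≥0∞) := by
  refine ⟨rademacherBits δ, rademacherBits_isEquivalent δ (by linarith), ?_⟩
  intro V _ _ N a ha
  exact ⟨N.compTime_anti _ _ _ δ zero_le_one, iSup₂_le fun S hS =>
    ofReal_rademacherBits_div_le N a ha δ hδ₀ (by linarith) S hS.1⟩
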